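/- All multigraphs are finite and undirected. Let $G$ be a multigraph with vertex set $V(G)$ and edge set $E(G)$. For distinct $u,v\in V(G)$, a $u$-$v$-edge-cut is a set $F\subseteq E(G)$ such that $u$ and $v$ lie in different components of $G-F$, and $\lambda(u,v)$ is the minimum number of edges in a $u$-$v$-edge-cut. The upper edge-connectivity of $G$ is $\lambda^+(G)=\max\{\lambda(u,v): u,v\in V(G),\ u\neq v\}$ (and $\lambda^+(G)=0$ if $G$ has at most one vertex). An edge-colouring of $G$, in which adjacent edges may receive the same colour, is a rainbow disconnection colouring if for any two distinct vertices $u,v$ there is a $u$-$v$-edge-cut whose edges have pairwise different colours. The rainbow disconnection number $\mathrm{rd}(G)$ is the smallest number of colours in a rainbow disconnection colouring of $G$. **Theorem.** For every finite loopless multigraph $G$, $$\mathrm{rd}(G)\le\left\lfloor\tfrac32\,\lambda^+(G)\right\rfloor .$$ Moreover, the bound is sharp: for the Petersen graph $P$ one has $\lambda^+(P)=3$ and $\mathrm{rd}(P)=4=\left\lfloor\tfrac32\,\lambda^+(P)\right\rfloor$. -/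

import Mathlib

/-!
Finite multigraphs are Mathlib's `Graph α β` with finite vertex and edge sets.
-/

namespace Graph

/-- `G.SameComponent u v`: the vertices `u` and `v` are joined by a walk in `G`, that is, they lie
in the same connected component of `G`. -/
def SameComponent {α β : Type*} (G : Graph α β) (u v : α) : Prop :=
  Relation.ReflTransGen G.Adj u v

/-- `G.IsCutBetween F u v`: `F` is a finite set of edges of `G` such that `u` and `v` lie in
different components of `G - F`. -/
def IsCutBetween {α β : Type*} (G : Graph α β) (F : Finset β) (u v : α) : Prop :=
  (F : Set β) ⊆ G.edgeSet ∧ ¬ (G.deleteEdges (F : Set β)).SameComponent u v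

/-- The local edge-connectivity `λ(u, v)`: the minimum number of edges in an edge-cut between
`u` and `v`. -/
noncomputable def localEdgeConn {α β : Type*} (G : Graph α β) (u v : α) : ℕ :=
  sInf {n : ℕ | ∃ F : Finset β, G.IsCutBetween F u v ∧ F.card = n}

/-- The upper edge-connectivity `λ⁺(G)`: the maximum of `λ(u, v)` over all pairs of distinct
vertices (and `0` if there is no such pair). -/
noncomputable def upperEdgeConn {α β : Type*} (G : Graph α β) : ℕ :=
  sSup {n : ℕ | ∃ u ∈ G.vertexSet, ∃ v ∈ G.vertexSet, u ≠ v ∧ G.localEdgeConn u v = n}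

/-- The edge-colouring `c` is a rainbow disconnection colouring of `G`: any two distinct vertices
are separated by an edge-cut whose edges have pairwise different colours. Adjacent edges may have
the same colour, and the values of `c` outside the edge set play no role. -/
def IsRainbowDisconnected {α β γ : Type*} (G : Graph α β) (c : β → γ) : Prop :=
  ∀ u ∈ G.vertexSet, ∀ v ∈ G.vertexSet, u ≠ v →
    ∃ F : Finset β, G.IsCutBetween F u v ∧ Set.InjOn c (F : Set β)

/-- The rainbow disconnection number `rd(G)`: the smallest `k` such that `G` has a rainbow
disconnection colouring of its edges with colours `0, …, k - 1`. -/
noncomputable def rainbowDisconnectionNumber {α β : Type*} (G : Graph α β) : ℕ :=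
  sInf {k : ℕ | ∃ c : β → ℕ, (∀ e ∈ G.edgeSet, c e < k) ∧ G.IsRainbowDisconnected c}

/-! The minima and the maximum above are attained on finite multigraphs. -/

theorem isCutBetween_edgeSet {α β : Type*} (G : Graph α β) (hE : G.edgeSet.Finite) {u v : α}
    (huv : u ≠ v) : G.IsCutBetween hE.toFinset u v := by
  refine ⟨by simp, fun h => huv ?_⟩
  refine Relation.ReflTransGen.head_induction_on h rfl ?_
  rintro a b ⟨e, he⟩ - -
  simp only [deleteEdges_isLink, Set.Finite.coe_toFinset] at he
  exact absurd he.1.edge_mem he.2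

theorem exists_isCutBetween_card_eq {α β : Type*} (G : Graph α β) (hE : G.edgeSet.Finite)
    {u v : α} (huv : u ≠ v) :
    ∃ F : Finset β, G.IsCutBetween F u v ∧ F.card = G.localEdgeConn u v :=
  Nat.sInf_mem (s := {n : ℕ | ∃ F : Finset β, G.IsCutBetween F u v ∧ F.card = n})
    ⟨_, _, G.isCutBetween_edgeSet hE huv, rfl⟩

theorem isGreatest_upperEdgeConn {α β : Type*} (G : Graph α β) (hE : G.edgeSet.Finite)
    (hV : G.vertexSet.Nontrivial) :
    IsGreatest {n : ℕ | ∃ u ∈ G.vertexSet, ∃ v ∈ G.vertexSet, u ≠ v ∧ G.localEdgeConn u v = n}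
      G.upperEdgeConn := by
  have hb : BddAbove {n : ℕ | ∃ u ∈ G.vertexSet, ∃ v ∈ G.vertexSet,
      u ≠ v ∧ G.localEdgeConn u v = n} := by
    refine ⟨hE.toFinset.card, ?_⟩
    rintro n ⟨u, -, v, -, huv, rfl⟩
    exact Nat.sInf_le ⟨_, G.isCutBetween_edgeSet hE huv, rfl⟩
  obtain ⟨u, hu, v, hv, huv⟩ := hV
  exact ⟨Nat.sSup_mem ⟨_, u, hu, v, hv, huv, rfl⟩ hb, fun n hn => le_csSup hb hn⟩

theorem exists_isRainbowDisconnected {α β : Type*} (G : Graph α β) (hE : G.edgeSet.Finite) :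
    ∃ c : β → ℕ, (∀ e ∈ G.edgeSet, c e < G.rainbowDisconnectionNumber) ∧
      G.IsRainbowDisconnected c := by
  classical
  refine Nat.sInf_mem (s := {k : ℕ | ∃ c : β → ℕ, (∀ e ∈ G.edgeSet, c e < k) ∧
    G.IsRainbowDisconnected c}) ⟨hE.toFinset.card, ?_⟩
  refine ⟨fun e => if h : e ∈ hE.toFinset then (hE.toFinset.equivFin ⟨e, h⟩ : ℕ) else 0, ?_, ?_⟩
  · intro e he
    have h : e ∈ hE.toFinset := by simpa using he
    simp only [h, dif_pos]
    exact (hE.toFinset.equivFin ⟨e, h⟩).isLt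
  · intro u _ v _ huv
    refine ⟨_, G.isCutBetween_edgeSet hE huv, ?_⟩
    intro a ha b hb hab
    have ha' : a ∈ hE.toFinset := ha
    have hb' : b ∈ hE.toFinset := hb
    simp only [ha', hb', dif_pos] at hab
    simpa using hE.toFinset.equivFin.injective (Fin.ext hab)

end Graph

/-- The Petersen graph: an outer 5-cycle on the vertices `(false, i)`, an inner pentagram on the
vertices `(true, i)`, and the five spokes joining `(false, i)` to `(true, i)`, for `i` modulo `5`. -/
def petersenGraph : SimpleGraph (Bool × ZMod 5) where
  Adj p q :=
    (p.1 = false ∧ q.1 = false ∧ (q.2 = p.2 + 1 ∨ p.2 = q.2 + 1)) ∨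
    (p.1 = true ∧ q.1 = true ∧ (q.2 = p.2 + 2 ∨ p.2 = q.2 + 2)) ∨
    (p.1 ≠ q.1 ∧ p.2 = q.2)
  symm := ⟨fun p q h => by
    rcases h with ⟨h₁, h₂, h₃⟩ | ⟨h₁, h₂, h₃⟩ | ⟨h₁, h₂⟩
    · exact Or.inl ⟨h₂, h₁, h₃.symm⟩
    · exact Or.inr (Or.inl ⟨h₂, h₁, h₃.symm⟩)
    · exact Or.inr (Or.inr ⟨h₁.symm, h₂.symm⟩)⟩
  loopless := ⟨by decide⟩

/-!
Let `d = λ⁺(G)`. The bound follows from Shannon's theorem, that a multigraph of maximum degree at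
most `d` has a proper edge-colouring with `⌊3 d / 2⌋` colours, by cutting `G` along minimum cuts.

If at most one vertex has degree greater than `d`, split it into pendant vertices. The result has
maximum degree at most `d`, and a proper colouring of it makes all stars of `G` rainbow except
possibly one; so of any two vertices, one is separated from the other by its own rainbow star
(`Multigraph.exists_isRainbow_of_subsingleton`). Otherwise let `A` be a side of a minimum cut
between two vertices of degree greater than `d`. This cut has at most `d` edges. Contracting `A` or
its complement to one vertex does not increase the upper edge-connectivity, by submodularity of the
cut function (`Multigraph.exists_cut_collapse`), and both contractions have fewer vertices of degree
greater than `d`. By induction they have colourings that are rainbow on all stars of at most `d`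
edges, in particular on the star of the contracted vertex, which is the cut. After a permutation of
colours they agree there and can be glued (`Multigraph.IsRainbow.glue`).

Shannon's theorem (`Multigraph.exists_isProperOn_of_degree_le`) is proved one edge `xy` at a time.
Take a colour missing at `x` and the edge `yz` of that colour. At least `k - d + 1` of the
`k = ⌊3 d / 2⌋` colours are missing at `x`, as many at `y`, and `k - d` at `z`, more than `k` in
total, so two of the three vertices miss a common colour. Then a direct recolouring works, or a
Kempe change if the two are `x` and `z`.

In the Petersen graph every cut with at most three edges contains the star of one of the separated
vertices (`Petersen.three_le_card_of_isCutBetween`), so a rainbow disconnection colouring with three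
colours would be proper at all vertices but one. By parity it would be proper everywhere, but the
Petersen graph has no proper edge-colouring with three colours
(`Petersen.not_injective_off_vertex`).
-/

/-! ### Proper edge-colourings and Kempe changes -/

namespace Multigraph

open Finset

section Shannon

variable {V E γ : Type*}

/-- For a multigraph given by the ends `ends e` of each edge `e`, the colouring `c` is proper on the
edges in `F`: distinct edges of `F` with a common end have different colours. -/
def IsProperOn (ends : E → Sym2 V) (c : E → γ) (F : Finset E) : Prop :=
  ∀ v, ∀ e ∈ F, ∀ f ∈ F, v ∈ ends e → v ∈ ends f → c e = c f → e = f

/-- The colour `a` is missing at the vertex `v`: no edge of `F` at `v` has colour `a`. -/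
def IsMissing (ends : E → Sym2 V) (c : E → γ) (F : Finset E) (v : V) (a : γ) : Prop :=
  ∀ e ∈ F, v ∈ ends e → c e ≠ a

theorem IsProperOn.mono {ends : E → Sym2 V} {c : E → γ} {F F' : Finset E}
    (h : IsProperOn ends c F) (hF : F' ⊆ F) : IsProperOn ends c F' :=
  fun v e he f hf => h v e (hF he) f (hF hf)

theorem IsMissing.mono {ends : E → Sym2 V} {c : E → γ} {F F' : Finset E} {v : V} {a : γ}
    (h : IsMissing ends c F v a) (hF : F' ⊆ F) : IsMissing ends c F' v a :=
  fun e he => h e (hF he)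

theorem IsProperOn.update_insert [DecidableEq E] {ends : E → Sym2 V} {c : E → γ} {F : Finset E}
    (h : IsProperOn ends c F) {e : E} (he : e ∉ F) {a : γ}
    (ha : ∀ v ∈ ends e, IsMissing ends c F v a) :
    IsProperOn ends (Function.update c e a) (insert e F) := by
  have hne : ∀ f ∈ F, f ≠ e := fun f hf hfe => he (hfe ▸ hf)
  intro v f hf g hg hvf hvg hc
  rcases mem_insert.1 hf with hfe | hfF <;> rcases mem_insert.1 hg with hge | hgF
  · rw [hfe, hge]
  · rw [hfe, Function.update_self, Function.update_of_ne (hne g hgF)] at hc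
    exact absurd hc.symm (ha v (hfe ▸ hvf) g hgF hvg)
  · rw [hge, Function.update_self, Function.update_of_ne (hne f hfF)] at hc
    exact absurd hc (ha v (hge ▸ hvg) f hfF hvf)
  · rw [Function.update_of_ne (hne f hfF), Function.update_of_ne (hne g hgF)] at hc
    exact h v f hfF g hgF hvf hvg hc

/-- The uncoloured edge `e = xy` can be coloured if an edge `f = yz` has a colour that is missing
at `x` and some other colour `b` is missing at both ends of `f`: recolour `f` with `b` and give its
old colour to `e`. -/
theorem IsProperOn.exists_insert_of_shift [DecidableEq E] {ends : E → Sym2 V} {c : E → γ}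
    {F : Finset E} (h : IsProperOn ends c F) {e f : E} (he : e ∉ F) (hf : f ∈ F) {x y : V}
    (hexy : ends e = s(x, y)) (hyf : y ∈ ends f) (hx : IsMissing ends c F x (c f))
    {b : γ} (hb : ∀ v ∈ ends f, IsMissing ends c F v b) :
    ∃ c' : E → γ, IsProperOn ends c' (insert e F) := by
  have hcb : c f ≠ b := hb y hyf f hf hyf
  have h1 : IsProperOn ends (Function.update c f b) F := by
    have := (h.mono (erase_subset f F)).update_insert (notMem_erase f F) (a := b)
      (fun v hv => (hb v hv).mono (erase_subset f F))
    rwa [insert_erase hf] at this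
  refine ⟨_, h1.update_insert he (a := c f) ?_⟩
  intro v hv g hg hvg hc
  by_cases hgf : g = f
  · subst hgf
    rw [Function.update_self] at hc
    exact hcb hc.symm
  · rw [Function.update_of_ne hgf] at hc
    rw [hexy, Sym2.mem_iff] at hv
    rcases hv with rfl | rfl
    · exact hx g hg hvg hc
    · exact hgf (h v g hg f hf hvg hyf hc)

/-- The subgraph formed by the edges of `F` with colour `a` or `b`. Its components are the Kempe
chains of these two colours. -/
def kempeGraph (ends : E → Sym2 V) (c : E → γ) (F : Finset E) (a b : γ) : SimpleGraph V where
  Adj u v := u ≠ v ∧ ∃ e ∈ F, ends e = s(u, v) ∧ (c e = a ∨ c e = b)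
  symm := ⟨fun u v h => ⟨h.1.symm, by simpa only [Sym2.eq_swap] using h.2⟩⟩
  loopless := ⟨fun _ h => h.1 rfl⟩

/-- Exchanging the colours `a` and `b` on the Kempe chains inside a union `C` of chains. -/
theorem IsProperOn.exists_swap [DecidableEq γ] {ends : E → Sym2 V} {c : E → γ} {F : Finset E}
    (h : IsProperOn ends c F) (a b : γ) (C : Set V)
    (hC : ∀ u v, (kempeGraph ends c F a b).Adj u v → u ∈ C → v ∈ C) :
    ∃ c' : E → γ, IsProperOn ends c' F ∧
      (∀ e ∈ F, ∀ v ∈ ends e, v ∈ C → c' e = Equiv.swap a b (c e)) ∧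
      (∀ e ∈ F, ∀ v ∈ ends e, v ∉ C → c' e = c e) := by
  classical
  let c' : E → γ := fun e => if ∃ v ∈ ends e, v ∈ C then Equiv.swap a b (c e) else c e
  have h1 : ∀ e ∈ F, ∀ v ∈ ends e, v ∈ C → c' e = Equiv.swap a b (c e) :=
    fun e _ v hv hvC => if_pos ⟨v, hv, hvC⟩
  have h2 : ∀ e ∈ F, ∀ v ∈ ends e, v ∉ C → c' e = c e := by
    intro e he v hv hvC
    by_cases hex : ∃ v ∈ ends e, v ∈ C
    · obtain ⟨u, hu, huC⟩ := id hex
      have huv : u ≠ v := fun h => hvC (h ▸ huC)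
      have hends : ends e = s(u, v) := (Sym2.mem_and_mem_iff huv).1 ⟨hu, hv⟩
      have hca : ¬ (c e = a ∨ c e = b) := fun hc => hvC (hC u v ⟨huv, e, he, hends, hc⟩ huC)
      rw [not_or] at hca
      exact (if_pos hex).trans (Equiv.swap_apply_of_ne_of_ne hca.1 hca.2)
    · exact if_neg hex
  refine ⟨c', ?_, h1, h2⟩
  intro v e he f hf hve hvf hc
  by_cases hv : v ∈ C
  · rw [h1 e he v hve hv, h1 f hf v hvf hv] at hc
    exact h v e he f hf hve hvf ((Equiv.swap a b).injective hc)
  · rw [h2 e he v hve hv, h2 f hf v hvf hv] at hc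
    exact h v e he f hf hve hvf hc

/-- A vertex of a properly coloured graph has at most one neighbour for each of the colours in `S`,
where `S` collects the colours of a Kempe graph that occur at that vertex. -/
theorem IsProperOn.kempeGraph_degree_le [Fintype V] {ends : E → Sym2 V} {c : E → γ} {F : Finset E}
    (h : IsProperOn ends c F) {a b : γ} {v : V} [Fintype ((kempeGraph ends c F a b).neighborSet v)]
    (S : Finset γ) (hS : ∀ e ∈ F, v ∈ ends e → (c e = a ∨ c e = b) → c e ∈ S) :
    (kempeGraph ends c F a b).degree v ≤ #S := by
  refine card_le_card_of_forall_subsingleton (fun w k => ∃ e ∈ F, ends e = s(v, w) ∧ c e = k) ?_ ?_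
  · intro w hw
    rw [SimpleGraph.mem_neighborFinset] at hw
    obtain ⟨_, e, he, hends, hc⟩ := hw
    exact ⟨c e, hS e he (by simp [hends]) hc, e, he, hends, rfl⟩
  · rintro k _ w ⟨_, e, he, hends, hc⟩ w' ⟨_, e', he', hends', hc'⟩
    have : e = e' := h v e he e' he' (by simp [hends]) (by simp [hends']) (hc.trans hc'.symm)
    subst this
    exact Sym2.congr_right.1 (hends.symm.trans hends')

end Shannon

/-- In a graph of maximum degree at most two, a component is a path or a cycle, so it contains at
most two vertices of degree less than two. -/
theorem not_reachable_of_degree_le_one {V : Type*} [Fintype V] (H : SimpleGraph V)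
    [DecidableRel H.Adj] (hdeg : ∀ v, H.degree v ≤ 2) {x y z : V} (hxy : x ≠ y) (hxz : x ≠ z)
    (hyz : y ≠ z) (hx : H.degree x ≤ 1) (hy : H.degree y ≤ 1) (hz : H.degree z ≤ 1)
    (h1 : H.Reachable x y) : ¬ H.Reachable z y := by
  classical
  intro h2
  let C := H.connectedComponentMk y
  have hconn : C.toSimpleGraph.Connected := C.connected_toSimpleGraph
  have hcount := hconn.card_vert_le_card_edgeSet_add_one
  have hsum := C.toSimpleGraph.sum_degrees_eq_twice_card_edges
  have hxC : x ∈ C := SimpleGraph.ConnectedComponent.sound h1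
  have hzC : z ∈ C := SimpleGraph.ConnectedComponent.sound h2
  have hyC : y ∈ C := rfl
  have hle : ∀ v : C, C.toSimpleGraph.degree v ≤ H.degree v := by
    intro v
    refine card_le_card_of_injOn (fun w : C => (w : V)) ?_ (Subtype.val_injective.injOn)
    intro w hw
    have hw' : C.toSimpleGraph.Adj v w := by simpa using hw
    exact (SimpleGraph.mem_neighborFinset _ _ _).2 (C.toSimpleGraph_hom.map_adj hw')
  let T : Finset C := {⟨x, hxC⟩, ⟨y, hyC⟩, ⟨z, hzC⟩}
  have hT : #T = 3 := by
    simp only [T]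
    rw [card_eq_three]
    exact ⟨_, _, _, by simpa using hxy, by simpa using hxz, by simpa using hyz, rfl⟩
  have hbound : ∀ v : C, C.toSimpleGraph.degree v + (if v ∈ T then 1 else 0) ≤ 2 := by
    intro v
    split_ifs with hv
    · simp only [T, mem_insert, mem_singleton] at hv
      have := hle v
      rcases hv with rfl | rfl | rfl <;> dsimp only at this <;> omega
    · exact (hle v).trans (hdeg v)
  have htot := sum_le_sum (fun v (_ : v ∈ (univ : Finset C)) => hbound v)
  rw [sum_add_distrib, hsum, sum_boole, sum_const] at htot
  simp only [filter_mem_eq_inter, univ_inter, hT, card_univ, smul_eq_mul] at htot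
  rw [Nat.card_eq_fintype_card, Nat.card_eq_fintype_card, ← SimpleGraph.edgeFinset_card] at hcount
  push_cast at htot
  omega

/-! ### Shannon's theorem -/

section Shannon

variable {V E : Type*}

theorem card_sub_le_card_isMissing [DecidableEq V] {k : ℕ} (ends : E → Sym2 V) (c : E → Fin k)
    (F : Finset E) (v : V) [DecidablePred (IsMissing ends c F v)] :
    k - #{e ∈ F | v ∈ ends e} ≤ #{a | IsMissing ends c F v a} := by
  have h : #({a | ¬ IsMissing ends c F v a} : Finset (Fin k)) ≤ #{e ∈ F | v ∈ ends e} := by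
    refine (card_le_card ?_).trans (card_image_le (f := c))
    intro a ha
    simp only [mem_filter, mem_univ, true_and, IsMissing, not_forall, not_not] at ha
    obtain ⟨e, he, hv, hc⟩ := ha
    exact mem_image.2 ⟨e, by simp [he, hv], hc⟩
  have := card_filter_add_card_filter_not (s := (univ : Finset (Fin k)))
    (fun a => IsMissing ends c F v a)
  simp only [card_univ, Fintype.card_fin] at this
  omega

/-- The Kempe change in Shannon's argument. The edge `e = xy` is uncoloured and `f = yz` has a
colour missing at `x`. If the colour `b` is missing at `x` and `z`, and `g` is missing at `y`, then
the `b`-`g`-chain of `y` does not end at both `x` and `z`, and exchanging the two colours on a chain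
that starts in `x` or `z` and avoids `y` makes `e` colourable. -/
theorem IsProperOn.exists_insert_of_missing [Fintype V] {γ : Type*} [DecidableEq E]
    {ends : E → Sym2 V} {c : E → γ} {F : Finset E} (h : IsProperOn ends c F) {e f : E} (he : e ∉ F)
    (hf : f ∈ F) {x y z : V} (hxy : x ≠ y) (hyz : y ≠ z) (hexy : ends e = s(x, y))
    (hfyz : ends f = s(y, z)) (hx : IsMissing ends c F x (c f)) {b g : γ}
    (hbx : IsMissing ends c F x b) (hbz : IsMissing ends c F z b) (hgy : IsMissing ends c F y g) :
    ∃ c' : E → γ, IsProperOn ends c' (insert e F) := by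
  classical
  have hxz : x ≠ z := by
    rintro rfl
    exact hx f hf (by simp [hfyz]) rfl
  let H := kempeGraph ends c F b g
  have hdeg : ∀ v, H.degree v ≤ 2 := by
    intro v
    refine (h.kempeGraph_degree_le {b, g} ?_).trans card_le_two
    intro e _ _ hc
    simpa using hc
  have hone : ∀ v k, IsMissing ends c F v k → k = b ∨ k = g → H.degree v ≤ 1 := by
    rintro v k hv (rfl | rfl)
    · refine (h.kempeGraph_degree_le {g} ?_).trans (card_singleton _).le
      intro e he hve hc
      simpa using hc.resolve_left (hv e he hve)
    · refine (h.kempeGraph_degree_le {b} ?_).trans (card_singleton _).le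
      intro e he hve hc
      simpa using hc.resolve_right (hv e he hve)
  -- A colour missing at the root of a swapped chain is traded for the other colour.
  have key : ∀ w, IsMissing ends c F w b → ¬ H.Reachable w y →
      ∃ c' : E → γ, IsProperOn ends c' F ∧ IsMissing ends c' F w g ∧ IsMissing ends c' F y g ∧
        (∀ e ∈ F, ∀ v ∈ ends e, ¬ H.Reachable w v → c' e = c e) ∧
        (∀ e ∈ F, ∀ v ∈ ends e, H.Reachable w v → c' e = Equiv.swap b g (c e)) := by
    intro w hw hwy
    obtain ⟨c', hc', hin, hout⟩ := h.exists_swap b g {v | H.Reachable w v}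
      (fun u v huv hu => SimpleGraph.Reachable.trans hu huv.reachable)
    refine ⟨c', hc', ?_, ?_, hout, hin⟩
    · intro e he hwe hc
      rw [hin e he w hwe (SimpleGraph.Reachable.refl w)] at hc
      refine hw e he hwe ?_
      exact (Equiv.swap b g).injective (hc.trans (Equiv.swap_apply_left b g).symm)
    · intro e he hye hc
      rw [hout e he y hye hwy] at hc
      exact hgy e he hye hc
  by_cases hreach : H.Reachable x y
  · have hzy := not_reachable_of_degree_le_one H hdeg hxy hxz hyz (hone x b hbx (Or.inl rfl))
      (hone y g hgy (Or.inr rfl)) (hone z b hbz (Or.inl rfl)) hreach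
    obtain ⟨c', hc', hzg, hyg, hout, -⟩ := key z hbz hzy
    have hzx : ¬ H.Reachable z x := fun hzx => hzy (hzx.trans hreach)
    refine hc'.exists_insert_of_shift he hf hexy (b := g) (by simp [hfyz]) ?_ ?_
    · intro k hk hxk hc
      rw [hout k hk x hxk hzx, hout f hf y (by simp [hfyz]) hzy] at hc
      exact hx k hk hxk hc
    · intro v hv
      rw [hfyz, Sym2.mem_iff] at hv
      rcases hv with rfl | rfl
      · exact hyg
      · exact hzg
  · obtain ⟨c', hc', hxg, hyg, -, -⟩ := key x hbx hreach
    refine ⟨_, hc'.update_insert he (a := g) ?_⟩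
    intro v hv
    rw [hexy, Sym2.mem_iff] at hv
    rcases hv with rfl | rfl
    · exact hxg
    · exact hyg

/-- Shannon's theorem: a multigraph of maximum degree at most `d` has a proper edge-colouring with
`⌊3 d / 2⌋` colours. -/
theorem exists_isProperOn_of_degree_le [Fintype V] [DecidableEq V] {d k : ℕ}
    (hk : 3 * d ≤ 2 * k + 1) (hk0 : 0 < k) (ends : E → Sym2 V) (F : Finset E)
    (hloop : ∀ e ∈ F, ¬ (ends e).IsDiag) (hdeg : ∀ v, #{e ∈ F | v ∈ ends e} ≤ d) :
    ∃ c : E → Fin k, IsProperOn ends c F := by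
  classical
  induction F using Finset.induction_on with
  | empty => exact ⟨fun _ => ⟨0, hk0⟩, fun v e he => absurd he (notMem_empty e)⟩
  | insert e F he ih =>
    have hmono : ∀ v, #{e ∈ F | v ∈ ends e} ≤ #{f ∈ insert e F | v ∈ ends f} := fun v =>
      card_le_card (filter_subset_filter _ (subset_insert e F))
    have hlt : ∀ v ∈ ends e, #{e ∈ F | v ∈ ends e} + 1 ≤ d := by
      intro v hv
      refine le_trans ?_ (hdeg v)
      rw [filter_insert, if_pos hv, card_insert_of_notMem (fun h => he (mem_filter.1 h).1)]
    obtain ⟨c, hc⟩ := ih (fun f hf => hloop f (mem_insert_of_mem hf))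
      (fun v => (hmono v).trans (hdeg v))
    obtain ⟨x, y, hexy⟩ : ∃ x y, ends e = s(x, y) :=
      Sym2.ind (f := fun p => ∃ x y, p = s(x, y)) (fun x y => ⟨x, y, rfl⟩) (ends e)
    have hxy : x ≠ y := by
      have := hloop e (mem_insert_self e F)
      rwa [hexy, Sym2.mk_isDiag_iff] at this
    let M : V → Finset (Fin k) := fun v => {a | IsMissing ends c F v a}
    have hM : ∀ v a, a ∈ M v ↔ IsMissing ends c F v a := by simp [M]
    have hMcard : ∀ v, k - #{e ∈ F | v ∈ ends e} ≤ #(M v) := fun v =>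
      card_sub_le_card_isMissing ends c F v
    have hdx := hlt x (by simp [hexy])
    have hdy := hlt y (by simp [hexy])
    have hMx := hMcard x
    have hMy := hMcard y
    by_cases hxyM : Disjoint (M x) (M y)
    swap
    · obtain ⟨a, hax, hay⟩ := not_disjoint_iff.1 hxyM
      refine ⟨_, hc.update_insert he (a := a) ?_⟩
      intro v hv
      rw [hexy, Sym2.mem_iff] at hv
      rcases hv with rfl | rfl
      · exact (hM _ _).1 hax
      · exact (hM _ _).1 hay
    obtain ⟨g, hg⟩ : (M y).Nonempty := card_pos.1 (by omega)
    obtain ⟨a, ha⟩ : (M x).Nonempty := card_pos.1 (by omega)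
    have hay : ¬ IsMissing ends c F y a := fun h =>
      disjoint_left.1 hxyM ha ((hM _ _).2 h)
    obtain ⟨f, hf, hyf, rfl⟩ : ∃ f ∈ F, y ∈ ends f ∧ c f = a := by
      simpa [IsMissing] using hay
    obtain ⟨z, hfyz⟩ := Sym2.mem_iff_exists.1 hyf
    have hyz : y ≠ z := by
      have := hloop f (mem_insert_of_mem hf)
      rwa [hfyz, Sym2.mk_isDiag_iff] at this
    have hMz := hMcard z
    have hdz := (hmono z).trans (hdeg z)
    rw [hM] at hg ha
    by_cases hyzM : Disjoint (M y) (M z)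
    swap
    · obtain ⟨b, hby, hbz⟩ := not_disjoint_iff.1 hyzM
      refine hc.exists_insert_of_shift he hf hexy hyf ha (b := b) ?_
      intro v hv
      rw [hfyz, Sym2.mem_iff] at hv
      rcases hv with rfl | rfl
      · exact (hM _ _).1 hby
      · exact (hM _ _).1 hbz
    -- Together the three sets have more than `k` elements, so `M x` meets `M z`.
    have hxzM : ¬ Disjoint (M x) (M z) := by
      intro hxzM
      have h3 : #(M x ∪ M y ∪ M z) ≤ k := by
        simpa using card_le_univ (M x ∪ M y ∪ M z)
      rw [card_union_of_disjoint (disjoint_union_left.2 ⟨hxzM, hyzM⟩),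
        card_union_of_disjoint hxyM] at h3
      omega
    obtain ⟨b, hbx, hbz⟩ := not_disjoint_iff.1 hxzM
    exact hc.exists_insert_of_missing he hf hxy hyz hexy hfyz ha ((hM _ _).1 hbx) ((hM _ _).1 hbz)
      hg

end Shannon

end Multigraph

/-! ### Cuts and contractions -/

namespace Multigraph

open Finset

section Cuts

variable {V E : Type*} [Fintype E]

open Classical in
/-- The edges with exactly one end in `X`. Loops belong to no cut. -/
noncomputable def cut (ends : E → Sym2 V) (X : Set V) : Finset E :=
  {e | ∃ a ∈ X, ∃ b ∉ X, ends e = s(a, b)}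

theorem mem_cut {ends : E → Sym2 V} {X : Set V} {e : E} {a b : V} (h : ends e = s(a, b)) :
    e ∈ cut ends X ↔ ¬ (a ∈ X ↔ b ∈ X) := by
  simp only [cut, mem_filter, mem_univ, true_and, h]
  constructor
  · rintro ⟨a', ha, b', hb, hab⟩
    rcases Sym2.eq_iff.1 hab with ⟨rfl, rfl⟩ | ⟨rfl, rfl⟩ <;> tauto
  · intro h
    by_cases ha : a ∈ X
    · exact ⟨a, ha, b, by tauto, rfl⟩
    · exact ⟨b, by tauto, a, ha, Sym2.eq_swap⟩

theorem exists_ends (p : Sym2 V) : ∃ a b, p = s(a, b) :=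
  Sym2.ind (f := fun p => ∃ a b, p = s(a, b)) (fun a b => ⟨a, b, rfl⟩) p

theorem cut_compl (ends : E → Sym2 V) (X : Set V) : cut ends Xᶜ = cut ends X := by
  ext e
  obtain ⟨a, b, h⟩ := exists_ends (ends e)
  rw [mem_cut h, mem_cut h, Set.mem_compl_iff, Set.mem_compl_iff]
  tauto

theorem cut_empty (ends : E → Sym2 V) : cut ends ∅ = ∅ := by
  ext e
  obtain ⟨a, b, h⟩ := exists_ends (ends e)
  simp [mem_cut h]

theorem cut_map {W : Type*} (ends : E → Sym2 V) (φ : V → W) (X : Set W) :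
    cut (fun e => (ends e).map φ) X = cut ends (φ ⁻¹' X) := by
  ext e
  obtain ⟨a, b, h⟩ := exists_ends (ends e)
  have h' : (ends e).map φ = s(φ a, φ b) := by rw [h, Sym2.map_mk]
  rw [mem_cut (ends := fun e => (ends e).map φ) h', mem_cut h, Set.mem_preimage, Set.mem_preimage]

theorem card_cut_inter_add_card_cut_union_le (ends : E → Sym2 V) (X Y : Set V) :
    #(cut ends (X ∩ Y)) + #(cut ends (X ∪ Y)) ≤ #(cut ends X) + #(cut ends Y) := by
  classical
  rw [← card_union_add_card_inter, ← card_union_add_card_inter (cut ends X)]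
  refine Nat.add_le_add (card_le_card fun e => ?_) (card_le_card fun e => ?_) <;>
  · obtain ⟨a, b, h⟩ := exists_ends (ends e)
    simp only [mem_union, mem_inter, mem_cut h, Set.mem_inter_iff, Set.mem_union]
    tauto

open Classical in
/-- The contraction of the vertex set `A` to the vertex `u`. All vertices are kept: those in
`A \ {u}` become isolated. -/
noncomputable def collapse (A : Set V) (u x : V) : V := if x ∈ A then u else x

theorem collapse_of_mem {A : Set V} {u x : V} (h : x ∈ A) : collapse A u x = u := if_pos h

theorem collapse_of_notMem {A : Set V} {u x : V} (h : x ∉ A) : collapse A u x = x := if_neg h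

theorem preimage_collapse_self {A : Set V} {u : V} (hu : u ∈ A) : collapse A u ⁻¹' {u} = A := by
  ext x
  by_cases hx : x ∈ A
  · simp [collapse_of_mem hx, hx]
  · have : x ≠ u := fun h => hx (h ▸ hu)
    simp [collapse_of_notMem hx, hx, this]

theorem preimage_collapse_of_notMem {A : Set V} {u w : V} (hu : u ∈ A) (hw : w ∉ A) :
    collapse A u ⁻¹' {w} = {w} := by
  ext x
  by_cases hx : x ∈ A
  · have h1 : x ≠ w := fun h => hw (h ▸ hx)
    have h2 : u ≠ w := fun h => hw (h ▸ hu)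
    simp [collapse_of_mem hx, h1, h2]
  · simp [collapse_of_notMem hx]

theorem preimage_collapse_of_mem_of_ne {A : Set V} {u w : V} (hw : w ∈ A) (hwu : w ≠ u) :
    collapse A u ⁻¹' {w} = ∅ := by
  ext x
  by_cases hx : x ∈ A
  · simp [collapse_of_mem hx, hwu.symm]
  · have h1 : x ≠ w := fun h => hx (h ▸ hw)
    simp [collapse_of_notMem hx, h1]

theorem preimage_collapse_of_subset {A X : Set V} {u : V} (hu : u ∈ A) (hX : A ⊆ X) :
    collapse A u ⁻¹' X = X := by
  ext x
  by_cases hx : x ∈ A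
  · simp [collapse_of_mem hx, hX hx, hX hu]
  · simp [collapse_of_notMem hx]

/-- Contracting one side `A` of a minimum cut between `u` and `v` does not increase the upper
edge-connectivity: a cut `X` with `u ∈ X` is uncrossed from `A` by passing to `A ∪ X`, because
`A ∩ X` separates `u` from `v`. -/
theorem exists_cut_collapse {ends : E → Sym2 V} {d : ℕ} {A : Set V} {u v : V} (hu : u ∈ A)
    (hv : v ∉ A) (hA : ∀ Y : Set V, u ∈ Y → v ∉ Y → #(cut ends A) ≤ #(cut ends Y))
    (hd : ∀ x y, x ≠ y → ∃ X : Set V, ¬ (x ∈ X ↔ y ∈ X) ∧ #(cut ends X) ≤ d) (x y : V)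
    (hxy : x ≠ y) :
    ∃ X : Set V, ¬ (x ∈ X ↔ y ∈ X) ∧ #(cut (fun e => (ends e).map (collapse A u)) X) ≤ d := by
  by_cases hx : x ∈ A ∧ x ≠ u
  · refine ⟨{x}, by simpa using hxy.symm, ?_⟩
    rw [cut_map, preimage_collapse_of_mem_of_ne hx.1 hx.2, cut_empty]
    exact Nat.zero_le d
  by_cases hy : y ∈ A ∧ y ≠ u
  · refine ⟨{y}, by simpa using hxy, ?_⟩
    rw [cut_map, preimage_collapse_of_mem_of_ne hy.1 hy.2, cut_empty]
    exact Nat.zero_le d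
  obtain ⟨X, huX, hX, hXd⟩ : ∃ X : Set V, u ∈ X ∧ ¬ (x ∈ X ↔ y ∈ X) ∧ #(cut ends X) ≤ d := by
    obtain ⟨X, hX, hXd⟩ := hd x y hxy
    by_cases huX : u ∈ X
    · exact ⟨X, huX, hX, hXd⟩
    · refine ⟨Xᶜ, huX, ?_, by rwa [cut_compl]⟩
      rw [Set.mem_compl_iff, Set.mem_compl_iff]
      tauto
  refine ⟨A ∪ X, ?_, ?_⟩
  · have h1 : x ∈ A → x ∈ X := fun h => by
      have : x = u := by tauto
      rwa [this]
    have h2 : y ∈ A → y ∈ X := fun h => by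
      have : y = u := by tauto
      rwa [this]
    rw [Set.mem_union, Set.mem_union]
    tauto
  · rw [cut_map, preimage_collapse_of_subset hu Set.subset_union_left]
    have h1 := card_cut_inter_add_card_cut_union_le ends A X
    have h2 := hA (A ∩ X) ⟨hu, huX⟩ (fun h => hv h.1)
    omega

end Cuts

/-! ### Rainbow cuts -/

section Rainbow

variable {V E : Type*} [Fintype E]

/-- A colouring that makes every star of at most `d` edges rainbow, and such that any two vertices
are separated by a rainbow cut. -/
structure IsRainbow {γ : Type*} (ends : E → Sym2 V) (d : ℕ) (c : E → γ) : Prop where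
  star : ∀ v, #(cut ends {v}) ≤ d → Set.InjOn c (cut ends {v})
  separated : ∀ x y, x ≠ y → ∃ X : Set V, ¬ (x ∈ X ↔ y ∈ X) ∧ Set.InjOn c (cut ends X)

/-- Two rainbow colourings of the same edges differ by a permutation of the colours. -/
theorem exists_perm_eq_on {E γ : Type*} [Finite γ] (f g : E → γ) (S : Set E) (hf : Set.InjOn f S)
    (hg : Set.InjOn g S) : ∃ σ : Equiv.Perm γ, ∀ e ∈ S, σ (g e) = f e := by
  classical
  have := Fintype.ofFinite γ
  let τ : {x // x ∈ g '' S} ≃ {x // x ∈ f '' S} :=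
    (Equiv.Set.imageOfInjOn g S hg).symm.trans (Equiv.Set.imageOfInjOn f S hf)
  refine ⟨τ.extendSubtype, fun e he => ?_⟩
  rw [τ.extendSubtype_apply_of_mem _ ⟨e, he, rfl⟩]
  have : (Equiv.Set.imageOfInjOn g S hg).symm ⟨g e, e, he, rfl⟩ = ⟨e, he⟩ := by
    rw [Equiv.symm_apply_eq]
    rfl
  simp only [τ, Equiv.trans_apply, this]
  rfl

/-- Colourings of the two contractions at a cut with at most `d` edges are glued along the cut,
after permuting the colours of one of them: the cut is the star of the contracted vertex in both
contractions, hence rainbow in both. -/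
theorem IsRainbow.glue {γ : Type*} [Finite γ] {ends : E → Sym2 V} {d : ℕ} {A : Set V} {u v : V}
    (hu : u ∈ A) (hv : v ∉ A) (hA : #(cut ends A) ≤ d) {c₁ c₂ : E → γ}
    (h₁ : IsRainbow (fun e => (ends e).map (collapse A u)) d c₁)
    (h₂ : IsRainbow (fun e => (ends e).map (collapse Aᶜ v)) d c₂) :
    ∃ c : E → γ, IsRainbow ends d c := by
  classical
  have i₁ : Set.InjOn c₁ (cut ends A) := by
    have := h₁.star u
    rw [cut_map, preimage_collapse_self hu] at this
    exact this hA
  have i₂ : Set.InjOn c₂ (cut ends A) := by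
    have := h₂.star v
    rw [cut_map, preimage_collapse_self (A := Aᶜ) hv, cut_compl] at this
    exact this hA
  obtain ⟨σ, hσ⟩ := exists_perm_eq_on c₁ c₂ _ i₁ i₂
  let c : E → γ := fun e => if ∀ a ∈ ends e, a ∈ A then σ (c₂ e) else c₁ e
  have e₁ : ∀ Y : Set V, (∀ a ∈ A, ∀ b ∈ A, a ∈ Y → b ∈ Y) → ∀ e ∈ cut ends Y, c e = c₁ e := by
    intro Y hY e he
    obtain ⟨a, b, hab⟩ := exists_ends (ends e)
    refine if_neg fun hin => ?_
    rw [mem_cut hab] at he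
    have ha := hin a (by simp [hab])
    have hb := hin b (by simp [hab])
    exact he ⟨hY a ha b hb, hY b hb a ha⟩
  have e₂ : ∀ Y : Set V, (∀ a ∉ A, ∀ b ∉ A, a ∈ Y → b ∈ Y) →
      ∀ e ∈ cut ends Y, c e = σ (c₂ e) := by
    intro Y hY e he
    by_cases hin : ∀ a ∈ ends e, a ∈ A
    · exact if_pos hin
    · obtain ⟨a, b, hab⟩ := exists_ends (ends e)
      have hcut : e ∈ cut ends A := by
        rw [mem_cut hab] at he ⊢
        simp only [hab, Sym2.mem_iff, forall_eq_or_imp, forall_eq] at hin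
        have h3 := hY a
        have h4 := hY b
        intro hiff
        have ha : a ∉ A := by tauto
        have hb : b ∉ A := by tauto
        exact he ⟨h3 ha b hb, h4 hb a ha⟩
      rw [hσ e hcut]
      exact if_neg hin
  have j₁ : ∀ X : Set V, Set.InjOn c₁ (cut ends (collapse A u ⁻¹' X)) →
      Set.InjOn c (cut ends (collapse A u ⁻¹' X)) := by
    intro X hX
    refine hX.congr fun e he => (e₁ _ ?_ e he).symm
    intro a ha b hb
    simp [collapse_of_mem ha, collapse_of_mem hb]
  have j₂ : ∀ X : Set V, Set.InjOn c₂ (cut ends (collapse Aᶜ v ⁻¹' X)) →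
      Set.InjOn c (cut ends (collapse Aᶜ v ⁻¹' X)) := by
    intro X hX
    refine (σ.injective.comp_injOn hX).congr fun e he => (e₂ _ ?_ e he).symm
    intro a ha b hb
    simp [collapse_of_mem (A := Aᶜ) ha, collapse_of_mem (A := Aᶜ) hb]
  refine ⟨c, ?_, ?_⟩
  · intro w hw
    by_cases hwA : w ∈ A
    · have := h₂.star w
      rw [cut_map] at this
      have hpre := preimage_collapse_of_notMem (A := Aᶜ) (u := v) (w := w) hv (not_not.2 hwA)
      have hj := j₂ {w}
      rw [hpre] at this hj
      exact hj (this hw)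
    · have := h₁.star w
      rw [cut_map] at this
      have hj := j₁ {w}
      rw [preimage_collapse_of_notMem hu hwA] at this hj
      exact hj (this hw)
  · intro x y hxy
    by_cases hx : x ∈ A <;> by_cases hy : y ∈ A
    · obtain ⟨X, hX, hXi⟩ := h₂.separated x y hxy
      rw [cut_map] at hXi
      refine ⟨_, ?_, j₂ X hXi⟩
      simpa [collapse_of_notMem (A := Aᶜ) (not_not.2 hx),
        collapse_of_notMem (A := Aᶜ) (not_not.2 hy)] using hX
    · exact ⟨A, by tauto, i₁.congr fun e he => (e₁ A (fun _ _ _ hb _ => hb) e he).symm⟩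
    · exact ⟨A, by tauto, i₁.congr fun e he => (e₁ A (fun _ _ _ hb _ => hb) e he).symm⟩
    · obtain ⟨X, hX, hXi⟩ := h₁.separated x y hxy
      rw [cut_map] at hXi
      refine ⟨_, ?_, j₁ X hXi⟩
      simpa [collapse_of_notMem hx, collapse_of_notMem hy] using hX

/-- If at most one vertex has degree greater than `d`, it is split into pendant vertices, one for
each incident edge, and Shannon's theorem applies. Of any two vertices one then has a rainbow
star. -/
theorem exists_isRainbow_of_subsingleton [Fintype V] {d k : ℕ} (hd : 0 < d)
    (hk : 3 * d ≤ 2 * k + 1) {ends : E → Sym2 V}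
    (hbig : {v | d < #(cut ends {v})}.Subsingleton) : ∃ c : E → Fin k, IsRainbow ends d c := by
  classical
  let split : E → V → V ⊕ E := fun e v => if d < #(cut ends {v}) then Sum.inr e else Sum.inl v
  let F : Finset E := {e | ¬ (ends e).IsDiag}
  have hF : ∀ e, e ∈ F ↔ ¬ (ends e).IsDiag := by simp [F]
  have hmem : ∀ v, ∀ e, e ∈ cut ends {v} ↔ e ∈ F ∧ v ∈ ends e := by
    intro v e
    obtain ⟨a, b, hab⟩ := exists_ends (ends e)
    rw [mem_cut hab, hF, hab]
    simp only [Set.mem_singleton_iff, Sym2.mk_isDiag_iff, Sym2.mem_iff]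
    constructor
    · intro h
      refine ⟨fun h' => h (by rw [h']), ?_⟩
      by_contra h'
      rw [not_or] at h'
      exact h (by simp [Ne.symm h'.1, Ne.symm h'.2])
    · rintro ⟨h, rfl | rfl⟩ h'
      · exact h (h'.1 rfl).symm
      · exact h (h'.2 rfl)
  have hinl : ∀ v, ¬ d < #(cut ends {v}) → ∀ e, v ∈ ends e →
      Sum.inl v ∈ (ends e).map (split e) := by
    intro v hv e he
    exact Sym2.mem_map.2 ⟨v, he, if_neg hv⟩
  have hloop : ∀ e ∈ F, ¬ ((ends e).map (split e)).IsDiag := by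
    intro e he
    obtain ⟨a, b, hab⟩ := exists_ends (ends e)
    rw [hF, hab, Sym2.mk_isDiag_iff] at he
    simp only [hab, Sym2.map_mk, Sym2.mk_isDiag_iff, split]
    split_ifs with h1 h2 h2
    · exact fun _ => he (hbig h1 h2)
    · simp
    · simp
    · simpa using he
  have hdeg : ∀ w, #{e ∈ F | w ∈ (ends e).map (split e)} ≤ d := by
    rintro (v | f)
    · by_cases hv : d < #(cut ends {v})
      · refine le_trans (le_of_eq (card_eq_zero.2 (filter_eq_empty_iff.2 ?_))) (Nat.zero_le d)
        intro e _ he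
        obtain ⟨w, _, hw⟩ := Sym2.mem_map.1 he
        simp only [split] at hw
        split_ifs at hw with h
        cases hw
        exact h hv
      · refine le_trans (card_le_card ?_) (not_lt.1 hv)
        intro e he
        obtain ⟨heF, he⟩ := mem_filter.1 he
        obtain ⟨w, hwe, hw⟩ := Sym2.mem_map.1 he
        simp only [split] at hw
        split_ifs at hw
        cases hw
        exact (hmem _ e).2 ⟨heF, hwe⟩
    · refine le_trans (card_le_card (t := {f}) ?_) ((card_singleton f).le.trans hd)
      intro e he
      obtain ⟨_, he⟩ := mem_filter.1 he
      obtain ⟨w, hwe, hw⟩ := Sym2.mem_map.1 he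
      simp only [split] at hw
      split_ifs at hw
      cases hw
      exact mem_singleton_self _
  obtain ⟨c, hc⟩ := exists_isProperOn_of_degree_le hk (by omega)
    (fun e => (ends e).map (split e)) F hloop hdeg
  have hstar : ∀ v, ¬ d < #(cut ends {v}) → Set.InjOn c (cut ends {v}) := by
    intro v hv e he f hf hef
    obtain ⟨he, hve⟩ := (hmem v e).1 he
    obtain ⟨hf, hvf⟩ := (hmem v f).1 hf
    exact hc (Sum.inl v) e he f hf (hinl v hv e hve) (hinl v hv f hvf) hef
  refine ⟨c, fun v hv => hstar v hv.not_gt, fun x y hxy => ?_⟩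
  by_cases hx : d < #(cut ends {x})
  · have hy : ¬ d < #(cut ends {y}) := fun hy => hxy (hbig hx hy)
    exact ⟨{y}, by simpa using hxy, hstar y hy⟩
  · exact ⟨{x}, by simpa using hxy.symm, hstar x hx⟩

/-- If any two vertices are separated by a cut of at most `d` edges, there is a rainbow colouring
with `⌊3 d / 2⌋` colours. As long as two vertices have degree greater than `d`, the graph is
contracted on either side of a minimum cut between them, which lowers the number of such
vertices. -/
theorem exists_isRainbow [Fintype V] {d k : ℕ} (hd : 0 < d) (hk : 3 * d ≤ 2 * k + 1)
    (ends : E → Sym2 V)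
    (hsep : ∀ x y, x ≠ y → ∃ X : Set V, ¬ (x ∈ X ↔ y ∈ X) ∧ #(cut ends X) ≤ d) :
    ∃ c : E → Fin k, IsRainbow ends d c := by
  classical
  induction hn : #({v | d < #(cut ends {v})} : Finset V) using Nat.strong_induction_on
    generalizing ends with
  | _ n ih =>
    subst hn
    by_cases hbig : {v | d < #(cut ends {v})}.Subsingleton
    · exact exists_isRainbow_of_subsingleton hd hk hbig
    obtain ⟨u, hu, v, hv, huv⟩ := Set.not_subsingleton_iff.1 hbig
    obtain ⟨A, ⟨huA, hvA⟩, hmin⟩ : ∃ A : Set V, (u ∈ A ∧ v ∉ A) ∧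
        ∀ Y : Set V, u ∈ Y → v ∉ Y → #(cut ends A) ≤ #(cut ends Y) := by
      obtain ⟨A, hA, hmin⟩ := Set.exists_min_image {A : Set V | u ∈ A ∧ v ∉ A}
        (fun A => #(cut ends A)) (Set.toFinite _) ⟨{u}, rfl, fun h => huv h.symm⟩
      exact ⟨A, hA, fun Y h1 h2 => hmin Y ⟨h1, h2⟩⟩
    have hAd : #(cut ends A) ≤ d := by
      obtain ⟨X, hX, hXd⟩ := hsep u v huv
      by_cases huX : u ∈ X
      · exact (hmin X huX (by tauto)).trans hXd
      · exact (hmin Xᶜ huX (fun h => h (by tauto))).trans (by rwa [cut_compl])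
    have hmin' : ∀ Y : Set V, v ∈ Y → u ∉ Y → #(cut ends Aᶜ) ≤ #(cut ends Y) := by
      intro Y h1 h2
      rw [cut_compl, ← cut_compl ends Y]
      exact hmin Yᶜ h2 (not_not.2 h1)
    have step : ∀ (B : Set V) (w : V), w ∈ B → #(cut ends B) ≤ d → d < #(cut ends {w}) →
        #({x | d < #(cut (fun e => (ends e).map (collapse B w)) {x})} : Finset V) <
          #({x | d < #(cut ends {x})} : Finset V) := by
      intro B w hw hB hwbig
      refine card_lt_card ((ssubset_iff_of_subset fun x hx => ?_).2 ⟨w, ?_, ?_⟩)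
      · rw [mem_filter, cut_map] at hx
        by_cases hxB : x ∈ B
        · exfalso
          by_cases hxw : x = w
          · rw [hxw, preimage_collapse_self hw] at hx
            exact hB.not_gt hx.2
          · rw [preimage_collapse_of_mem_of_ne hxB hxw, cut_empty] at hx
            exact Nat.not_lt_zero _ hx.2
        · rw [preimage_collapse_of_notMem hw hxB] at hx
          exact mem_filter.2 hx
      · simpa using hwbig
      · rw [mem_filter, cut_map, preimage_collapse_self hw]
        exact fun h => hB.not_gt h.2
    obtain ⟨c₁, h₁⟩ := ih _ (step A u huA hAd hu) _ (exists_cut_collapse huA hvA hmin hsep) rfl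
    obtain ⟨c₂, h₂⟩ := ih _ (step Aᶜ v hvA (by rwa [cut_compl]) hv) _
      (exists_cut_collapse (A := Aᶜ) hvA (not_not.2 huA) hmin' hsep) rfl
    exact IsRainbow.glue huA hvA hAd h₁ h₂

end Rainbow

end Multigraph

/-! ### The upper bound -/

namespace Multigraph

open Finset

/-- A set of edges separates `u` from `v` if and only if it contains all edges that leave some
vertex set containing `u` but not `v`. -/
theorem isCutBetween_iff {α β : Type*} {G : Graph α β} {F : Finset β} {u v : α} :
    G.IsCutBetween F u v ↔ (F : Set β) ⊆ G.edgeSet ∧ ∃ X : Set α, u ∈ X ∧ v ∉ X ∧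
      ∀ e a b, G.IsLink e a b → a ∈ X → b ∉ X → e ∈ F := by
  refine and_congr_right fun _ => ⟨fun h => ?_, ?_⟩
  · refine ⟨{w | (G.deleteEdges (F : Set β)).SameComponent u w}, Relation.ReflTransGen.refl, h, ?_⟩
    intro e a b hab ha hb
    by_contra he
    refine hb (Relation.ReflTransGen.tail ha ⟨e, ?_⟩)
    rw [Graph.deleteEdges_isLink]
    exact ⟨hab, he⟩
  · rintro ⟨X, hu, hv, hX⟩ h
    refine hv (Relation.ReflTransGen.rec hu ?_ h)
    rintro a b _ ⟨e, he⟩ ha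
    rw [Graph.deleteEdges_isLink] at he
    by_contra hb
    exact he.2 (hX e a b he.1 ha hb)

theorem localEdgeConn_le_upperEdgeConn {α β : Type*} {G : Graph α β} (hE : G.edgeSet.Finite)
    {u v : α} (hu : u ∈ G.vertexSet) (hv : v ∈ G.vertexSet) (huv : u ≠ v) :
    G.localEdgeConn u v ≤ G.upperEdgeConn :=
  (G.isGreatest_upperEdgeConn hE ⟨u, hu, v, hv, huv⟩).2 ⟨u, hu, v, hv, huv, rfl⟩

theorem rainbowDisconnectionNumber_le {α β : Type*} {G : Graph α β} {k : ℕ} (c : β → ℕ)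
    (hc : ∀ e ∈ G.edgeSet, c e < k) (h : G.IsRainbowDisconnected c) :
    G.rainbowDisconnectionNumber ≤ k :=
  Nat.sInf_le ⟨c, hc, h⟩

theorem floor_three_halves_mul (d : ℕ) : ⌊(3 / 2 : ℚ) * (d : ℚ)⌋₊ = 3 * d / 2 := by
  have h : (3 / 2 : ℚ) * (d : ℚ) = ((3 * d : ℕ) : ℚ) / ((2 : ℕ) : ℚ) := by
    push_cast
    ring
  rw [h, Nat.floor_div_natCast, Nat.floor_natCast]

theorem rainbowDisconnectionNumber_le_three_halves {α β : Type*} (G : Graph α β)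
    (hV : G.vertexSet.Finite) (hE : G.edgeSet.Finite) (hG : G.Loopless) :
    G.rainbowDisconnectionNumber ≤ 3 * G.upperEdgeConn / 2 := by
  classical
  have := hV.fintype
  have := hE.fintype
  rcases Nat.eq_zero_or_pos G.upperEdgeConn with h0 | hpos
  · -- Without positive edge-connectivity there are no edges, and no colours are needed.
    have hempty : ∀ e, e ∉ G.edgeSet := by
      intro e he
      obtain ⟨a, b, hab⟩ := Graph.exists_isLink_of_mem_edgeSet he
      have hle := localEdgeConn_le_upperEdgeConn hE hab.left_mem hab.right_mem hab.ne
      obtain ⟨F, hF, hcard⟩ := G.exists_isCutBetween_card_eq hE hab.ne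
      have hF0 : F = ∅ := card_eq_zero.1 (by omega)
      obtain ⟨-, X, ha, hb, hX⟩ := isCutBetween_iff.1 hF
      have := hX e a b hab ha hb
      rw [hF0] at this
      exact absurd this (notMem_empty e)
    have hEe : hE.toFinset = ∅ := by
      ext e
      simp [hempty e]
    refine rainbowDisconnectionNumber_le (fun _ => 0) (fun e he => absurd he (hempty e)) ?_
    intro u _ v _ huv
    refine ⟨_, G.isCutBetween_edgeSet hE huv, ?_⟩
    rw [hEe]
    simp
  have hends : ∀ e : G.edgeSet, ∃ p : Sym2 G.vertexSet, ∀ a b, G.IsLink e a b →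
      ∀ (ha : a ∈ G.vertexSet) (hb : b ∈ G.vertexSet), p = s(⟨a, ha⟩, ⟨b, hb⟩) := by
    intro e
    obtain ⟨a, b, hab⟩ := Graph.exists_isLink_of_mem_edgeSet e.2
    refine ⟨s(⟨a, hab.left_mem⟩, ⟨b, hab.right_mem⟩), ?_⟩
    intro a' b' hab' ha' hb'
    rcases hab.eq_and_eq_or_eq_and_eq hab' with ⟨rfl, rfl⟩ | ⟨rfl, rfl⟩
    · rfl
    · exact Sym2.eq_swap
  choose ends hends using hends
  obtain ⟨c, hc⟩ := exists_isRainbow (k := 3 * G.upperEdgeConn / 2) hpos (by omega) ends (by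
    rintro ⟨x, hx⟩ ⟨y, hy⟩ hxy
    have hne : x ≠ y := fun h => hxy (Subtype.ext h)
    obtain ⟨F, hF, hcard⟩ := G.exists_isCutBetween_card_eq hE hne
    obtain ⟨-, X, hxX, hyX, hX⟩ := isCutBetween_iff.1 hF
    refine ⟨Subtype.val ⁻¹' X, by simp [hxX, hyX], ?_⟩
    refine le_trans ?_ (hcard.le.trans (localEdgeConn_le_upperEdgeConn hE hx hy hne))
    refine card_le_card_of_injOn (fun e => (e : β)) ?_ Subtype.val_injective.injOn
    intro e he
    obtain ⟨a, b, hab⟩ := Graph.exists_isLink_of_mem_edgeSet e.2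
    rw [mem_coe, mem_cut (hends e a b hab hab.left_mem hab.right_mem)] at he
    simp only [Set.mem_preimage] at he
    by_cases ha : a ∈ X
    · exact hX e a b hab ha (by tauto)
    · exact hX e b a hab.symm (by tauto) ha)
  refine rainbowDisconnectionNumber_le (fun e => if h : e ∈ G.edgeSet then (c ⟨e, h⟩ : ℕ) else 0)
    (fun e he => by simp only [he, dif_pos]; exact (c ⟨e, he⟩).isLt) ?_
  intro u hu v hv huv
  obtain ⟨X, hXuv, hX⟩ : ∃ X : Set G.vertexSet, (⟨u, hu⟩ ∈ X ∧ ⟨v, hv⟩ ∉ X) ∧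
      Set.InjOn c (cut ends X) := by
    obtain ⟨X, hXuv, hX⟩ := hc.separated ⟨u, hu⟩ ⟨v, hv⟩ (fun h => huv (congrArg Subtype.val h))
    by_cases huX : ⟨u, hu⟩ ∈ X
    · exact ⟨X, by tauto, hX⟩
    · refine ⟨Xᶜ, ⟨huX, fun h => h (by tauto)⟩, by rwa [cut_compl]⟩
  refine ⟨(cut ends X).map (Function.Embedding.subtype _), isCutBetween_iff.2
    ⟨by intro e he; simp at he; exact he.1, Subtype.val '' X, ?_, ?_, ?_⟩, ?_⟩
  · exact ⟨_, hXuv.1, rfl⟩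
  · rintro ⟨w, hw, rfl⟩
    exact hXuv.2 hw
  · rintro e a b hab ⟨a, ha, rfl⟩ hb
    refine mem_map.2 ⟨⟨e, hab.edge_mem⟩, ?_, rfl⟩
    rw [mem_cut (hends ⟨e, hab.edge_mem⟩ a b hab hab.left_mem hab.right_mem)]
    have hb' : (⟨b, hab.right_mem⟩ : G.vertexSet) ∉ X := fun h => hb ⟨_, h, rfl⟩
    simpa [ha] using hb'
  · intro e he f hf hef
    simp only [coe_map, Function.Embedding.subtype_apply, Set.mem_image, mem_coe] at he hf
    obtain ⟨e, he, rfl⟩ := he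
    obtain ⟨f, hf, rfl⟩ := hf
    simp only [Subtype.coe_prop, dif_pos, Subtype.coe_eta] at hef
    rw [hX he hf (Fin.ext hef)]

end Multigraph

/-! ### The Petersen graph -/

namespace Petersen

open Finset

/-- First ends of the edges of the Petersen graph, listed as the outer edges `(0, i)`, the inner
edges `(1, i)` and the spokes `(2, i)`. -/
def src (j : Fin 3 × ZMod 5) : Bool × ZMod 5 := (![false, true, false] j.1, j.2)

/-- Second ends of the edges of the Petersen graph, in the order of `Petersen.src`. -/
def tgt (j : Fin 3 × ZMod 5) : Bool × ZMod 5 :=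
  (![false, true, true] j.1, ![j.2 + 1, j.2 + 2, j.2] j.1)

/-- The edges of the Petersen graph. -/
def edge (j : Fin 3 × ZMod 5) : Sym2 (Bool × ZMod 5) := s(src j, tgt j)

/-- The three edges at a vertex: the edges leaving and entering it on its cycle, and its spoke. -/
def starIndex : Bool × ZMod 5 → Fin 3 → Fin 3 × ZMod 5
  | (false, i) => ![(0, i), (0, i - 1), (2, i)]
  | (true, i) => ![(1, i), (1, i - 2), (2, i)]

instance : DecidableRel petersenGraph.Adj := fun p q => inferInstanceAs (Decidable
  ((p.1 = false ∧ q.1 = false ∧ (q.2 = p.2 + 1 ∨ p.2 = q.2 + 1)) ∨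
    (p.1 = true ∧ q.1 = true ∧ (q.2 = p.2 + 2 ∨ p.2 = q.2 + 2)) ∨ (p.1 ≠ q.1 ∧ p.2 = q.2)))

theorem adj_src_tgt (j : Fin 3 × ZMod 5) : petersenGraph.Adj (src j) (tgt j) := by
  revert j
  decide

theorem edge_injective : Function.Injective edge := by decide

theorem starIndex_injective (v : Bool × ZMod 5) : Function.Injective (starIndex v) := by
  revert v
  decide

theorem src_or_tgt_starIndex (v : Bool × ZMod 5) (k : Fin 3) :
    src (starIndex v k) = v ∨ tgt (starIndex v k) = v := by
  revert v k
  decide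

theorem exists_edge_starIndex {v w : Bool × ZMod 5} (h : petersenGraph.Adj v w) :
    ∃ k, edge (starIndex v k) = s(v, w) := by
  revert v w
  decide +kernel

/-- For a set of `m` vertices, given by its indicator `a` on the outer and `b` on the inner cycle,
the number `n` of edges leaving it is at least three if the set is neither empty nor everything, and
at least four unless the set or its complement is a single vertex. -/
theorem cut_count (a₀ a₁ a₂ a₃ a₄ b₀ b₁ b₂ b₃ b₄ : Bool) :
    let m := a₀.toNat + a₁.toNat + a₂.toNat + a₃.toNat + a₄.toNat +
      (b₀.toNat + b₁.toNat + b₂.toNat + b₃.toNat + b₄.toNat)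
    let n := (a₀ ^^ a₁).toNat + (a₁ ^^ a₂).toNat + (a₂ ^^ a₃).toNat + (a₃ ^^ a₄).toNat +
      (a₄ ^^ a₀).toNat + ((b₀ ^^ b₂).toNat + (b₁ ^^ b₃).toNat + (b₂ ^^ b₄).toNat +
      (b₃ ^^ b₀).toNat + (b₄ ^^ b₁).toNat) + ((a₀ ^^ b₀).toNat + (a₁ ^^ b₁).toNat +
      (a₂ ^^ b₂).toNat + (a₃ ^^ b₃).toNat + (a₄ ^^ b₄).toNat)
    m = 0 ∨ m = 10 ∨ (3 ≤ n ∧ (m = 1 ∨ m = 9 ∨ 4 ≤ n)) := by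
  revert a₀ a₁ a₂ a₃ a₄ b₀ b₁ b₂ b₃ b₄
  decide +kernel

-- Each colour is constrained as soon as it is introduced, which keeps the case tree small.
set_option synthInstance.maxSize 100000 in
set_option synthInstance.maxHeartbeats 2000000 in
/-- The Petersen graph has no proper edge-colouring with three colours; `o`, `s` and `n` are the
colours of the outer edges, the spokes and the inner edges. -/
theorem no_three_colouring : ∀ o₀ o₁ : Fin 3, o₀ ≠ o₁ → ∀ s₁, s₁ ≠ o₀ → s₁ ≠ o₁ →
    ∀ o₂, o₁ ≠ o₂ → ∀ s₂, s₂ ≠ o₁ → s₂ ≠ o₂ → ∀ o₃, o₂ ≠ o₃ → ∀ s₃, s₃ ≠ o₂ → s₃ ≠ o₃ →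
    ∀ o₄, o₃ ≠ o₄ → o₄ ≠ o₀ → ∀ s₄, s₄ ≠ o₃ → s₄ ≠ o₄ → ∀ s₀, s₀ ≠ o₄ → s₀ ≠ o₀ →
    ∀ n₀, n₀ ≠ s₀ → n₀ ≠ s₂ → ∀ n₂, n₂ ≠ n₀ → n₂ ≠ s₂ → n₂ ≠ s₄ →
    ∀ n₄, n₄ ≠ n₂ → n₄ ≠ s₄ → n₄ ≠ s₁ → ∀ n₁, n₁ ≠ n₄ → n₁ ≠ s₁ → n₁ ≠ s₃ →
    ∀ n₃, n₃ ≠ n₁ → n₃ ≠ s₃ → n₃ ≠ s₀ → n₃ ≠ n₀ → False := by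
  decide +kernel

/-- The nonzero elements of the Klein four-group as colours: three colours are pairwise different
precisely if they sum to zero. -/
def klein : Fin 3 → ZMod 2 × ZMod 2 := ![(0, 1), (1, 0), (1, 1)]

theorem klein_sum_eq_zero_iff (f : Fin 3 → Fin 3) :
    klein (f 0) + klein (f 1) + klein (f 2) = 0 ↔ Function.Injective f := by
  revert f
  decide

/-- The Petersen graph has no edge-colouring with three colours that is proper at all vertices but
one. With colours in the Klein four-group, the sum over all stars counts every edge twice, so it
vanishes, and then the star of the remaining vertex sums to zero and is rainbow as well. -/
theorem not_injective_off_vertex (c : Fin 3 × ZMod 5 → Fin 3) (z : Bool × ZMod 5)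
    (h : ∀ v ≠ z, Function.Injective fun k => c (starIndex v k)) : False := by
  let S : Bool × ZMod 5 → ZMod 2 × ZMod 2 := fun v =>
    klein (c (starIndex v 0)) + klein (c (starIndex v 1)) + klein (c (starIndex v 2))
  have hS : ∀ v ≠ z, S v = 0 := fun v hv =>
    (klein_sum_eq_zero_iff fun k => c (starIndex v k)).2 (h v hv)
  have htwo : ∀ x : ZMod 2 × ZMod 2, x + x = 0 := by decide
  have hshift : ∀ (f : ZMod 5 → ZMod 2 × ZMod 2) (a : ZMod 5), ∑ i, f (i - a) = ∑ i, f i :=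
    fun f a => Equiv.sum_comp (Equiv.subRight a) f
  have hsum : ∑ v, S v = 0 := by
    have h0 := hshift (fun i => klein (c (0, i))) 1
    have h1 := hshift (fun i => klein (c (1, i))) 2
    simp only [S, Fintype.sum_prod_type, Fintype.sum_bool, starIndex, Matrix.cons_val,
      sum_add_distrib, h0, h1, htwo]
  have hall : ∀ v, Function.Injective fun k => c (starIndex v k) := by
    intro v
    by_cases hv : v = z
    · subst hv
      rw [sum_eq_single v (fun w _ hw => hS w hw) (fun hw => absurd (mem_univ v) hw)] at hsum
      exact (klein_sum_eq_zero_iff fun k => c (starIndex v k)).1 hsum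
    · exact h v hv
  have hne : ∀ v k l, k ≠ l → c (starIndex v k) ≠ c (starIndex v l) :=
    fun v k l hkl => (hall v).ne hkl
  refine no_three_colouring (c (0, 0)) (c (0, 1)) ?_ (c (2, 1)) ?_ ?_ (c (0, 2)) ?_ (c (2, 2)) ?_ ?_
    (c (0, 3)) ?_ (c (2, 3)) ?_ ?_ (c (0, 4)) ?_ ?_ (c (2, 4)) ?_ ?_ (c (2, 0)) ?_ ?_
    (c (1, 0)) ?_ ?_ (c (1, 2)) ?_ ?_ ?_ (c (1, 4)) ?_ ?_ ?_ (c (1, 1)) ?_ ?_ ?_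
    (c (1, 3)) ?_ ?_ ?_ ?_
  · exact hne (false, 1) 1 0 (by decide)
  · exact hne (false, 1) 2 1 (by decide)
  · exact hne (false, 1) 2 0 (by decide)
  · exact hne (false, 2) 1 0 (by decide)
  · exact hne (false, 2) 2 1 (by decide)
  · exact hne (false, 2) 2 0 (by decide)
  · exact hne (false, 3) 1 0 (by decide)
  · exact hne (false, 3) 2 1 (by decide)
  · exact hne (false, 3) 2 0 (by decide)
  · exact hne (false, 4) 1 0 (by decide)
  · exact hne (false, 0) 1 0 (by decide)
  · exact hne (false, 4) 2 1 (by decide)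
  · exact hne (false, 4) 2 0 (by decide)
  · exact hne (false, 0) 2 1 (by decide)
  · exact hne (false, 0) 2 0 (by decide)
  · exact hne (true, 0) 0 2 (by decide)
  · exact hne (true, 2) 1 2 (by decide)
  · exact hne (true, 2) 0 1 (by decide)
  · exact hne (true, 2) 0 2 (by decide)
  · exact hne (true, 4) 1 2 (by decide)
  · exact hne (true, 4) 0 1 (by decide)
  · exact hne (true, 4) 0 2 (by decide)
  · exact hne (true, 1) 1 2 (by decide)
  · exact hne (true, 1) 0 1 (by decide)
  · exact hne (true, 1) 0 2 (by decide)
  · exact hne (true, 3) 1 2 (by decide)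
  · exact hne (true, 3) 0 1 (by decide)
  · exact hne (true, 3) 0 2 (by decide)
  · exact hne (true, 0) 1 2 (by decide)
  · exact hne (true, 0) 1 0 (by decide)

/-- The edges at the vertex `v`. -/
def star (v : Bool × ZMod 5) : Finset (Sym2 (Bool × ZMod 5)) :=
  univ.image fun k => edge (starIndex v k)

theorem isCutBetween_star {u v : Bool × ZMod 5} (huv : u ≠ v) :
    (Graph.ofSimpleGraph petersenGraph).IsCutBetween (star u) u v := by
  refine Multigraph.isCutBetween_iff.2 ⟨?_, {u}, rfl, huv.symm, ?_⟩
  · intro e he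
    obtain ⟨k, -, rfl⟩ := mem_image.1 (mem_coe.1 he)
    exact adj_src_tgt _
  · rintro e a b hab rfl -
    obtain ⟨rfl, he⟩ := hab
    obtain ⟨k, hk⟩ := exists_edge_starIndex (v := a) (w := b) he
    exact mem_image.2 ⟨k, mem_univ k, hk⟩

/-- Every edge-cut of the Petersen graph has at least three edges, and one with exactly three edges
contains the star of one of the two vertices that it separates. -/
theorem three_le_card_of_isCutBetween {u v : Bool × ZMod 5} {F : Finset (Sym2 (Bool × ZMod 5))}
    (h : (Graph.ofSimpleGraph petersenGraph).IsCutBetween F u v) :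
    3 ≤ #F ∧ (#F ≤ 3 → star u ⊆ F ∨ star v ⊆ F) := by
  classical
  obtain ⟨-, X, hu, hv, hX⟩ := Multigraph.isCutBetween_iff.1 h
  have hX' : ∀ j, ¬ (src j ∈ X ↔ tgt j ∈ X) → edge j ∈ F := by
    intro j hj
    have hlink : (Graph.ofSimpleGraph petersenGraph).IsLink (edge j) (src j) (tgt j) :=
      ⟨rfl, adj_src_tgt j⟩
    by_cases hs : src j ∈ X
    · exact hX _ _ _ hlink hs (by tauto)
    · exact hX _ _ _ hlink.symm (by tauto) hs
  have hstar : ∀ w, (∀ x, x ≠ w → (x ∈ X ↔ w ∉ X)) → star w ⊆ F := by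
    intro w hw e he
    obtain ⟨k, -, rfl⟩ := mem_image.1 he
    refine hX' _ ?_
    have hne := (adj_src_tgt (starIndex w k)).ne
    rcases src_or_tgt_starIndex w k with hor | hor
    · have := hw _ (hor ▸ hne.symm)
      rw [hor]
      tauto
    · have := hw _ (hor ▸ hne)
      rw [hor]
      tauto
  let f : Bool × ZMod 5 → Bool := fun w => decide (w ∈ X)
  have hfive : ∀ g : ZMod 5 → ℕ, ∑ i, g i = g 0 + g 1 + g 2 + g 3 + g 4 :=
    fun g => Fin.sum_univ_five g
  have hn : ∑ j, (f (src j) ^^ f (tgt j)).toNat ≤ #F := by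
    have h1 : ∀ j, (f (src j) ^^ f (tgt j)).toNat =
        if ¬ (src j ∈ X ↔ tgt j ∈ X) then 1 else 0 := by
      intro j
      by_cases h1 : src j ∈ X <;> by_cases h2 : tgt j ∈ X <;> simp [f, h1, h2]
    rw [sum_congr rfl fun j _ => h1 j, ← card_filter]
    exact card_le_card_of_injOn edge (fun j hj => hX' j (mem_filter.1 hj).2) edge_injective.injOn
  have hm : ∑ w, (f w).toNat = #{w | w ∈ X} := by
    rw [card_filter]
    exact sum_congr rfl fun w _ => by by_cases hw : w ∈ X <;> simp [f, hw]
  have hm' : #{w | w ∈ X} + #{w | w ∉ X} = 10 := by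
    rw [card_filter_add_card_filter_not]
    rfl
  have hu' : 0 < #{w | w ∈ X} := card_pos.2 ⟨u, by simpa using hu⟩
  have hv' : 0 < #{w | w ∉ X} := card_pos.2 ⟨v, by simpa using hv⟩
  rw [Fintype.sum_prod_type, Fintype.sum_bool, hfive, hfive] at hm
  rw [Fintype.sum_prod_type, Fin.sum_univ_three, hfive, hfive, hfive] at hn
  have hcount := cut_count (f (false, 0)) (f (false, 1)) (f (false, 2)) (f (false, 3))
    (f (false, 4)) (f (true, 0)) (f (true, 1)) (f (true, 2)) (f (true, 3)) (f (true, 4))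
  dsimp only at hcount
  rw [add_comm, hm] at hcount
  rcases hcount with h0 | h0 | ⟨h3, hcount⟩
  · omega
  · omega
  refine ⟨h3.trans hn, fun hF => ?_⟩
  rcases hcount with h1 | h9 | h4
  · left
    obtain ⟨w, hw⟩ := card_eq_one.1 h1
    have hmem : ∀ x, x ∈ X ↔ x = w := fun x => by simpa using congrArg (x ∈ ·) hw
    obtain rfl := (hmem u).1 hu
    exact hstar u fun x hx => by simp [hmem, hx]
  · right
    obtain ⟨w, hw⟩ := card_eq_one.1 (show #{w | w ∉ X} = 1 by omega)
    have hmem : ∀ x, x ∉ X ↔ x = w := fun x => by simpa using congrArg (x ∈ ·) hw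
    obtain rfl := (hmem v).1 hv
    exact hstar v fun x hx => by
      have := (hmem x).not.2 hx
      tauto
  · exact absurd (h4.trans (hn.trans hF)) (by decide)

theorem localEdgeConn_eq_three {u v : Bool × ZMod 5} (huv : u ≠ v) :
    (Graph.ofSimpleGraph petersenGraph).localEdgeConn u v = 3 := by
  refine le_antisymm (le_trans (Nat.sInf_le ⟨star u, isCutBetween_star huv, rfl⟩) ?_) ?_
  · exact card_image_le.trans (by simp)
  · obtain ⟨F, hF, hcard⟩ := Graph.exists_isCutBetween_card_eq
      (Graph.ofSimpleGraph petersenGraph) (Set.toFinite _) huv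
    exact hcard ▸ (three_le_card_of_isCutBetween hF).1

theorem upperEdgeConn_eq_three : (Graph.ofSimpleGraph petersenGraph).upperEdgeConn = 3 := by
  have hne : ((false, 0) : Bool × ZMod 5) ≠ (true, 0) := by decide
  obtain ⟨u, -, v, -, huv, h⟩ := (Graph.isGreatest_upperEdgeConn
    (Graph.ofSimpleGraph petersenGraph) (Set.toFinite _)
    ⟨_, Set.mem_univ (false, 0), _, Set.mem_univ (true, 0), hne⟩).1
  rw [← h, localEdgeConn_eq_three huv]

/-- With three colours a rainbow cut has at most three edges, so it contains the star of one of the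
two vertices that it separates. Hence all stars but one would be rainbow. -/
theorem four_le_rainbowDisconnectionNumber :
    4 ≤ (Graph.ofSimpleGraph petersenGraph).rainbowDisconnectionNumber := by
  by_contra hlt
  obtain ⟨c, hc, hrd⟩ := Graph.exists_isRainbowDisconnected
    (Graph.ofSimpleGraph petersenGraph) (Set.toFinite _)
  have hc3 : ∀ e ∈ (Graph.ofSimpleGraph petersenGraph).edgeSet, c e < 3 :=
    fun e he => (hc e he).trans_le (by omega)
  have hbad : {v | ¬ Set.InjOn c (star v)}.Subsingleton := by
    intro u hu v hv
    by_contra huv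
    obtain ⟨F, hF, hinj⟩ := hrd u (Set.mem_univ u) v (Set.mem_univ v) huv
    have hcard : #F ≤ 3 := by
      simpa using card_le_card_of_injOn c (t := range 3)
        (fun e he => by simpa using hc3 e (hF.1 he)) hinj
    rcases (three_le_card_of_isCutBetween hF).2 hcard with h | h
    · exact hu (hinj.mono (by exact_mod_cast h))
    · exact hv (hinj.mono (by exact_mod_cast h))
  obtain ⟨z, hz⟩ : ∃ z, ∀ v ≠ z, Set.InjOn c (star v) := by
    rcases hbad.eq_empty_or_singleton with h | ⟨z, h⟩
    · refine ⟨(false, 0), fun v _ => ?_⟩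
      by_contra hv
      exact (h ▸ hv : v ∈ (∅ : Set (Bool × ZMod 5)))
    · refine ⟨z, fun v hvz => ?_⟩
      by_contra hv
      exact hvz (h ▸ hv : v ∈ ({z} : Set (Bool × ZMod 5)))
  refine not_injective_off_vertex (fun j => ⟨c (edge j), hc3 _ (adj_src_tgt j)⟩) z ?_
  intro v hv k l hkl
  have := hz v hv (mem_coe.2 (mem_image_of_mem _ (mem_univ k)))
    (mem_coe.2 (mem_image_of_mem _ (mem_univ l))) (congrArg Fin.val hkl)
  exact starIndex_injective v (edge_injective this)

end Petersen

/-! ### The bound and its sharpness -/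

theorem mainTheorem1 :
    (∀ {α : Type*} {β : Type*} (G : Graph α β), G.vertexSet.Finite → G.edgeSet.Finite →
      G.Loopless →
        G.rainbowDisconnectionNumber ≤ ⌊(3 / 2 : ℚ) * (G.upperEdgeConn : ℚ)⌋₊) ∧
    ((Graph.ofSimpleGraph petersenGraph).upperEdgeConn = 3 ∧
      (Graph.ofSimpleGraph petersenGraph).rainbowDisconnectionNumber = 4 ∧
      (Graph.ofSimpleGraph petersenGraph).rainbowDisconnectionNumber =
        ⌊(3 / 2 : ℚ) * ((Graph.ofSimpleGraph petersenGraph).upperEdgeConn : ℚ)⌋₊) := by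
  have hloop : (Graph.ofSimpleGraph petersenGraph).Loopless :=
    ⟨fun _ _ h => petersenGraph.irrefl (h.1 ▸ h.2 : s(_, _) ∈ petersenGraph.edgeSet)⟩
  have hle : (Graph.ofSimpleGraph petersenGraph).rainbowDisconnectionNumber ≤ 4 := by
    have := Multigraph.rainbowDisconnectionNumber_le_three_halves
      (Graph.ofSimpleGraph petersenGraph) (Set.toFinite _) (Set.toFinite _) hloop
    rwa [Petersen.upperEdgeConn_eq_three] at this
  have heq := le_antisymm hle Petersen.four_le_rainbowDisconnectionNumber
  refine ⟨fun G hV hE hG => ?_, Petersen.upperEdgeConn_eq_three, heq, ?_⟩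
  · rw [Multigraph.floor_three_halves_mul]
    exact Multigraph.rainbowDisconnectionNumber_le_three_halves G hV hE hG
  · rw [heq, Multigraph.floor_three_halves_mul, Petersen.upperEdgeConn_eq_three]
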